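/- For elements $x,y$ of a group write $[x,y]=x^{-1}y^{-1}xy$, and let $[G,G]$ be the commutator subgroup of $G$. Let $\mathcal N_2$ be the variety of all groups that are nilpotent of class at most $2$. For $G\in\mathcal N_2$ and a subgroup $H\le G$, the dominion of $H$ in $G$ in $\mathcal N_2$ is $$\mathrm{dom}_G^{\mathcal N_2}(H)=\{a\in G : \text{for all } K\in\mathcal N_2 \text{ and all homomorphisms } f,g\colon G\to K,\ \text{if } f|_H=g|_H \text{ then } f(a)=g(a)\}.$$ Theorem. Let $G\in\mathcal N_2$ and let $H$ be a subgroup of $G$. Let $D$ be the subgroup of $G$ generated by all elements of $H$ together with all elements of the form $[x,y]^q$, where $x,y\in G$, $q\ge 0$ is an integer, and there exist $x',y'\in[G,G]$ such that $x^q x'\in H$ and $y^q y'\in H$. Then $D=\mathrm{dom}_G^{\mathcal N_2}(H)$. -/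

import Mathlib

universe u

/-- `G` is nilpotent of class at most `c`: the lower central series `G₁ = G`, `Gᵢ₊₁ = [Gᵢ, G]`
satisfies `G_{c+1} = 1`. Mathlib's series starts at index `0`, so `G_{c+1}` has index `c`. -/
def NilpotentOfClassLE (c : ℕ) (G : Type u) [Group G] : Prop :=
  (⊤ : Subgroup G).lowerCentralSeries c = ⊥

/-- The dominion of the subgroup `H` of `G` in the full subcategory of groups given by the
predicate `𝒞`: the elements of `G` on which any two morphisms from `G` to a group of `𝒞` agree as
soon as they agree on `H`. -/
def dominion (𝒞 : ∀ (K : Type u) [Group K], Prop) {G : Type u} [Group G] (H : Subgroup G) :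
    Subgroup G where
  carrier := {a | ∀ (K : Type u) [Group K], 𝒞 K → ∀ f g : G →* K,
    (∀ h ∈ H, f h = g h) → f a = g a}
  one_mem' := by
    intro K _ _ f g _
    rw [map_one, map_one]
  mul_mem' := by
    intro a b ha hb K _ hK f g hfg
    rw [map_mul, map_mul, ha K hK f g hfg, hb K hK f g hfg]
  inv_mem' := by
    intro a ha K _ hK f g hfg
    rw [map_inv, map_inv, ha K hK f g hfg]

/-! In class two the commutator is bilinear, so `[x,y]^q` can be carried from `f` to `g` one entry
at a time; this gives `D ≤ dom`. Conversely, the test group `Gᵃᵇ/im H` reduces the claim to `c` in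
`[G,G]`, hence central. If `c ∉ D`, a character `χ` of the center with values in `ℚ/ℤ` kills `D ∩
Z(G)` but not `c`. Let `A = Gᵃᵇ`, let `B` be the image of `H`, and let `b` be the pairing `χ([x,y])`
on `A`. The generators `[x,y]^q` of `D` say exactly that `q b(x,y) = 0` whenever `qx, qy ∈ B`. This
is the obstruction, of `Tor` type, to a pairing `γ` that is `0` on `B × A` and `b` on `A × B`
(`exists_pairing_extension`). With `γ` as cocycle, a quotient of a central extension of `G × G`
receives two maps from `G` that agree on `H` and differ at `c` (`exists_homs_ne`). -/

open scoped commutatorElement IsMulCommutative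

/-! ### Extending pairings with values in `ℚ/ℤ` -/

section Extension

open TensorProduct Module

/-- A pairing on `C × R`, with `R` a submodule of a finite free abelian group `F`, which vanishes
on the pairs `(c, q • v)` with `q • c = 0`, vanishes on the tensors `∑ cᵢ ⊗ rᵢ` whose image in
`C ⊗ F` is zero. -/
theorem sum_pairing_eq_zero_of_basis {F C M ι κ : Type*} [AddCommGroup F] [AddCommGroup C]
    [AddCommGroup M] [Finite ι] (bF : Basis ι ℤ F) (R : Submodule ℤ F)
    (φ : C →ₗ[ℤ] R →ₗ[ℤ] M)
    (hφ : ∀ (c : C) (q : ℤ) (v : F) (h : q • v ∈ R), q • c = 0 → φ c ⟨q • v, h⟩ = 0)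
    (s : Finset κ) (c : κ → C) (r : κ → R)
    (h : ∀ l : F →ₗ[ℤ] ℤ, ∑ i ∈ s, l (r i) • c i = 0) :
    ∑ i ∈ s, φ (c i) (r i) = 0 := by
  obtain ⟨n, S⟩ := R.smithNormalForm bF
  have key : ∀ i, φ (c i) (r i) = ∑ k, φ (S.bN.repr (r i) k • c i) (S.bN k) := by
    intro i
    conv_lhs => rw [← S.bN.sum_repr (r i)]
    simp only [map_sum, map_smul, LinearMap.smul_apply]
  simp_rw [key]
  rw [Finset.sum_comm]
  refine Finset.sum_eq_zero fun k _ => ?_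
  rw [← LinearMap.sum_apply, ← map_sum]
  -- By the Smith form, `a k` times the `k`-th coordinate of `r i` in `R` is its `f k`-th coordinate
  -- in the basis of `F`. Hence `h`, for that coordinate functional, says that `a k` kills the
  -- collected coefficient.
  have hk : S.bN k = ⟨S.a k • S.bM (S.f k), S.snf k ▸ (S.bN k).2⟩ := Subtype.ext (S.snf k)
  rw [hk]
  apply hφ
  rw [Finset.smul_sum, ← h (S.bM.coord (S.f k))]
  refine Finset.sum_congr rfl fun i _ => ?_
  rw [smul_smul]
  congr 1
  rw [Basis.coord_apply, S.repr_apply_embedding_eq_repr_smul]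
  simp

/-- The same for a free abelian group of arbitrary rank. -/
theorem sum_pairing_eq_zero_of_finsupp {α C M κ : Type*} [AddCommGroup C]
    [AddCommGroup M] (R : Submodule ℤ (α →₀ ℤ))
    (φ : C →ₗ[ℤ] R →ₗ[ℤ] M)
    (hφ : ∀ (c : C) (q : ℤ) (v : α →₀ ℤ) (h : q • v ∈ R), q • c = 0 → φ c ⟨q • v, h⟩ = 0)
    (s : Finset κ) (c : κ → C) (r : κ → R)
    (h : ∀ l : (α →₀ ℤ) →ₗ[ℤ] ℤ, ∑ i ∈ s, l (r i) • c i = 0) :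
    ∑ i ∈ s, φ (c i) (r i) = 0 := by
  classical
  -- Only finitely many coordinates occur in the `r i`, which reduces to finite rank.
  let T : Finset α := s.biUnion fun i => (r i : α →₀ ℤ).support
  let e : (T →₀ ℤ) →ₗ[ℤ] (α →₀ ℤ) := Finsupp.lmapDomain ℤ ℤ Subtype.val
  let d : (α →₀ ℤ) →ₗ[ℤ] (T →₀ ℤ) := Finsupp.lsubtypeDomain (T : Set α)
  have hed : ∀ i ∈ s, e (d (r i)) = r i := by
    intro i hi
    have hsub : ∀ a ∈ (r i : α →₀ ℤ).support, a ∈ T := fun a ha =>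
      Finset.mem_biUnion.2 ⟨i, hi, ha⟩
    ext a
    by_cases ha : a ∈ T
    · exact Finsupp.mapDomain_apply Subtype.val_injective _ (⟨a, ha⟩ : T)
    · have h0 : (r i : α →₀ ℤ) a = 0 := by
        by_contra hne
        exact ha (hsub a (Finsupp.mem_support_iff.2 hne))
      rw [h0]
      exact Finsupp.mapDomain_of_notMem_range _ _ (by simpa using ha)
  let ρ : R.comap e →ₗ[ℤ] R := e.restrict fun x hx => hx
  have hmem : ∀ i : s, d (r i) ∈ R.comap e := fun i => by
    rw [Submodule.mem_comap, hed i i.2]; exact (r i).2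
  have := sum_pairing_eq_zero_of_basis (Finsupp.basisSingleOne (R := ℤ) (ι := T)) (R.comap e)
    (φ.compl₂ ρ) (by
      intro c q v hv hc
      have := hφ c q (e v) (by rw [← map_smul]; exact hv) hc
      rw [LinearMap.compl₂_apply, ← this]
      congr 1
      exact Subtype.ext (map_smul e q v)) s.attach (fun i => c i) (fun i => ⟨d (r i), hmem i⟩)
    (by
      intro l
      rw [← h (l ∘ₗ d), ← Finset.sum_attach s]
      rfl)
  rw [← Finset.sum_attach, ← this]
  refine Finset.sum_congr rfl fun i _ => ?_
  rw [LinearMap.compl₂_apply]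
  congr 1
  exact Subtype.ext (hed i i.2).symm

/-- `Φ` descends to `X / ker f`, which embeds in `Y`, and `ℚ/ℤ` is injective. -/
theorem exists_character_comp_eq {X Y : Type*} [AddCommGroup X] [AddCommGroup Y]
    (f : X →ₗ[ℤ] Y) (Φ : X →ₗ[ℤ] AddCircle (1 : ℚ))
    (h : LinearMap.ker f ≤ LinearMap.ker Φ) :
    ∃ Ψ : Y →+ AddCircle (1 : ℚ), ∀ x, Ψ (f x) = Φ x := by
  obtain ⟨Ψ, hΨ⟩ := CharacterModule.dual_surjective_of_injective
    ((LinearMap.ker f).liftQ f le_rfl)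
    (LinearMap.ker_eq_bot.1 (Submodule.ker_liftQ_eq_bot' _ _ rfl))
    ((LinearMap.ker f).liftQ Φ h).toAddMonoidHom
  exact ⟨Ψ, fun x => DFunLike.congr_fun hΨ (Submodule.Quotient.mk x)⟩

/-- A pairing `b` with values in `ℚ/ℤ` such that `q b(x,y) = 0` whenever `q x` and `q y` lie in the
subgroup `B` can be modified to a pairing that vanishes on `B × A` and agrees with `b` on
`A × B`. -/
theorem exists_pairing_extension {A : Type*} [AddCommGroup A] (B : Submodule ℤ A)
    (b : A →ₗ[ℤ] A →ₗ[ℤ] AddCircle (1 : ℚ))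
    (hb : ∀ (x y : A) (q : ℤ), q • x ∈ B → q • y ∈ B → q • b x y = 0) :
    ∃ γ : A →+ A →+ AddCircle (1 : ℚ),
      (∀ x ∈ B, ∀ y, γ x y = 0) ∧ ∀ x, ∀ y ∈ B, γ x y = b x y := by
  let p : (A →₀ ℤ) →ₗ[ℤ] A := Finsupp.linearCombination ℤ id
  have hp : ∀ y, p (Finsupp.single y 1) = y := fun y => by simp [p]
  let R : Submodule ℤ (A →₀ ℤ) := B.comap p
  let φ : (A ⧸ B) →ₗ[ℤ] R →ₗ[ℤ] AddCircle (1 : ℚ) :=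
    B.liftQ (b.compl₂ (p ∘ₗ R.subtype)) (by
      intro x hx
      ext r
      -- The case `q = 1`: `b` vanishes on `B × B`.
      have := hb x (p r) 1 (by simpa using hx) (by rw [one_smul]; exact r.2)
      simpa using this)
  have hφ : ∀ x (r : R), φ (B.mkQ x) r = b x (p r) := fun x r => rfl
  have hker : LinearMap.ker (R.subtype.lTensor (A ⧸ B)) ≤ LinearMap.ker (lift φ) := by
    intro t ht
    obtain ⟨k, c, r, rfl⟩ := exists_sum_tmul_eq t
    rw [LinearMap.mem_ker, map_sum] at ht ⊢
    simp only [lift.tmul, LinearMap.lTensor_tmul] at ht ⊢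
    refine sum_pairing_eq_zero_of_finsupp R φ ?_ _ c r ?_
    · intro c q v hv hc
      obtain ⟨x, rfl⟩ := B.mkQ_surjective c
      rw [hφ]
      have hx : q • x ∈ B := by
        rwa [← map_smul, Submodule.mkQ_apply, Submodule.Quotient.mk_eq_zero] at hc
      have := hb x (p v) q hx (by rw [← map_smul]; exact hv)
      simpa using this
    · intro l
      have := congrArg ((TensorProduct.rid ℤ (A ⧸ B)).toLinearMap ∘ₗ l.lTensor (A ⧸ B)) ht
      simpa using this
  obtain ⟨Ψ, hΨ⟩ := exists_character_comp_eq _ _ hker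
  have hval : ∀ x (r : A →₀ ℤ), p r ∈ B → Ψ (B.mkQ x ⊗ₜ r) = b x (p r) := fun x r hr =>
    hΨ (B.mkQ x ⊗ₜ ⟨r, hr⟩)
  -- The defect of additivity of `y ↦ single y 1` lies in `ker p ≤ R`, where `Ψ` is given by `b x 0
  -- = 0`.
  have hadd : ∀ x y y', Ψ (B.mkQ x ⊗ₜ Finsupp.single (y + y') 1) =
      Ψ (B.mkQ x ⊗ₜ Finsupp.single y 1) + Ψ (B.mkQ x ⊗ₜ Finsupp.single y' 1) := by
    intro x y y'
    rw [← map_add, ← tmul_add, ← sub_eq_zero, ← map_sub, ← tmul_sub]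
    have h0 : p (Finsupp.single (y + y') 1 - (Finsupp.single y 1 + Finsupp.single y' 1)) = 0 := by
      simp [hp]
    rw [hval, h0, map_zero]
    rw [h0]; exact B.zero_mem
  refine ⟨AddMonoidHom.mk' (fun x => AddMonoidHom.mk'
    (fun y => Ψ (B.mkQ x ⊗ₜ Finsupp.single y 1)) (hadd x)) ?_, ?_, ?_⟩
  · intro x x'
    ext y
    simp [add_tmul]
  · intro x hx y
    have : B.mkQ x = 0 := by simpa using hx
    simp only [AddMonoidHom.mk'_apply, this, zero_tmul, map_zero]
  · intro x y hy
    have := hval x (Finsupp.single y 1) (by rwa [hp])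
    rwa [hp] at this

end Extension

theorem nilpotentOfClassLE_two_iff {G : Type u} [Group G] :
    NilpotentOfClassLE 2 G ↔ ∀ x y z : G, ⁅⁅x, y⁆, z⁆ = 1 := by
  rw [NilpotentOfClassLE, Subgroup.lowerCentralSeries_succ, Subgroup.top_lowerCentralSeries_one,
    Subgroup.commutator_eq_bot_iff_le_centralizer, commutator_def, Subgroup.commutator_le]
  simp only [Subgroup.mem_top, forall_const, Subgroup.mem_centralizer_iff_commutator_eq_one]
  constructor
  · intro h x y z
    rw [← commutatorElement_inv, h x y z trivial, inv_one]
  · intro h x y z _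
    rw [← commutatorElement_inv, h x y z, inv_one]

/-! ### The central extension of `G × G` defined by a pairing -/

section Twisted

variable {G : Type u} [Group G] {A M : Type*} [AddCommGroup A] [AddCommGroup M]

/-- The central extension of `G × G` by `M` with the cocycle `γ(x', y)`, where `γ` is a pairing
on an abelian quotient of `G`. -/
@[ext]
structure TwistedProd (π : G →* Multiplicative A) (γ : A →+ A →+ M) where
  /-- The first coordinate. -/
  left : G
  /-- The second coordinate. -/
  right : G
  /-- The central coordinate. -/
  val : M

namespace TwistedProd

variable {π : G →* Multiplicative A} {γ : A →+ A →+ M}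

instance : Mul (TwistedProd π γ) :=
  ⟨fun a b => ⟨a.left * b.left, a.right * b.right,
    a.val + b.val + γ (π b.left).toAdd (π a.right).toAdd⟩⟩

instance : One (TwistedProd π γ) := ⟨⟨1, 1, 0⟩⟩

instance : Inv (TwistedProd π γ) :=
  ⟨fun a => ⟨a.left⁻¹, a.right⁻¹, -a.val + γ (π a.left).toAdd (π a.right).toAdd⟩⟩

@[simp] theorem mul_left (a b : TwistedProd π γ) : (a * b).left = a.left * b.left := rfl
@[simp] theorem mul_right (a b : TwistedProd π γ) : (a * b).right = a.right * b.right := rfl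
@[simp] theorem mul_val (a b : TwistedProd π γ) :
    (a * b).val = a.val + b.val + γ (π b.left).toAdd (π a.right).toAdd := rfl
@[simp] theorem one_left : (1 : TwistedProd π γ).left = 1 := rfl
@[simp] theorem one_right : (1 : TwistedProd π γ).right = 1 := rfl
@[simp] theorem one_val : (1 : TwistedProd π γ).val = 0 := rfl
@[simp] theorem inv_left (a : TwistedProd π γ) : a⁻¹.left = a.left⁻¹ := rfl
@[simp] theorem inv_right (a : TwistedProd π γ) : a⁻¹.right = a.right⁻¹ := rfl
@[simp] theorem inv_val (a : TwistedProd π γ) :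
    a⁻¹.val = -a.val + γ (π a.left).toAdd (π a.right).toAdd := rfl

instance : Group (TwistedProd π γ) :=
  Group.ofLeftAxioms
    (by
      intro a b c
      ext
      · simp [mul_assoc]
      · simp [mul_assoc]
      · simp; abel)
    (by intro a; ext <;> simp)
    (by intro a; ext <;> simp)

/-- `π` kills commutators, so `γ` contributes nothing to a commutator with one of them. -/
theorem nilpotentOfClassLE_two (hG : NilpotentOfClassLE 2 G) :
    NilpotentOfClassLE 2 (TwistedProd π γ) := by
  rw [nilpotentOfClassLE_two_iff] at hG ⊢
  intro a b c
  have h1 := hG a.left b.left c.left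
  have h2 := hG a.right b.right c.right
  rw [commutatorElement_def, commutatorElement_def] at h1 h2 ⊢
  ext
  · simpa using h1
  · simpa using h2
  · simp; abel

/-- The inclusion of the first factor. -/
def inl : G →* TwistedProd π γ where
  toFun x := ⟨x, 1, 0⟩
  map_one' := rfl
  map_mul' x y := by ext <;> simp

/-- The inclusion of the second factor. -/
def inr : G →* TwistedProd π γ where
  toFun x := ⟨1, x, 0⟩
  map_one' := rfl
  map_mul' x y := by ext <;> simp

@[simp] theorem inl_left (x : G) : (inl x : TwistedProd π γ).left = x := rfl
@[simp] theorem inl_right (x : G) : (inl x : TwistedProd π γ).right = 1 := rfl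
@[simp] theorem inl_val (x : G) : (inl x : TwistedProd π γ).val = 0 := rfl
@[simp] theorem inr_left (x : G) : (inr x : TwistedProd π γ).left = 1 := rfl
@[simp] theorem inr_right (x : G) : (inr x : TwistedProd π γ).right = x := rfl
@[simp] theorem inr_val (x : G) : (inr x : TwistedProd π γ).val = 0 := rfl

end TwistedProd

theorem NilpotentOfClassLE.of_surjective {K L : Type u} [Group K] [Group L]
    (hK : NilpotentOfClassLE 2 K) (f : K →* L) (hf : Function.Surjective f) :
    NilpotentOfClassLE 2 L := by
  rw [nilpotentOfClassLE_two_iff] at hK ⊢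
  intro x y z
  obtain ⟨x, rfl⟩ := hf x
  obtain ⟨y, rfl⟩ := hf y
  obtain ⟨z, rfl⟩ := hf z
  rw [← map_commutatorElement, ← map_commutatorElement, hK, map_one]

end Twisted

theorem NilpotentOfClassLE.commutator_mem_center {G : Type u} [Group G]
    (hG : NilpotentOfClassLE 2 G) (x y : G) : ⁅x, y⁆ ∈ Subgroup.center G := by
  rw [Subgroup.mem_center_iff]
  intro z
  exact (commutatorElement_eq_one_iff_mul_comm.1 (nilpotentOfClassLE_two_iff.1 hG x y z)).symm

/-- The commutator pairing of a group of class at most two. -/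
def commutatorPairing {G : Type u} [Group G] (hG : NilpotentOfClassLE 2 G) :
    G →* G →* Subgroup.center G :=
  MonoidHom.mk' (fun x => MonoidHom.mk' (fun y => ⟨⁅x, y⁆, hG.commutator_mem_center x y⟩) (by
    intro y y'
    ext
    have h := Subgroup.mem_center_iff.1 (hG.commutator_mem_center x y') y
    calc ⁅x, y * y'⁆ = ⁅x, y⁆ * (y * ⁅x, y'⁆ * y⁻¹) := by
          simp only [commutatorElement_def]; group
      _ = ⁅x, y⁆ * ⁅x, y'⁆ := by rw [h, mul_inv_cancel_right])) (by
    intro x x'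
    ext y
    have h := Subgroup.mem_center_iff.1 (hG.commutator_mem_center x' y) x
    have h' := Subgroup.mem_center_iff.1 (hG.commutator_mem_center x y) ⁅x', y⁆
    calc ⁅x * x', y⁆ = (x * ⁅x', y⁆ * x⁻¹) * ⁅x, y⁆ := by
          simp only [commutatorElement_def]; group
      _ = ⁅x, y⁆ * ⁅x', y⁆ := by rw [h, mul_inv_cancel_right, h'])

@[simp]
theorem coe_commutatorPairing {G : Type u} [Group G] (hG : NilpotentOfClassLE 2 G) (x y : G) :
    (commutatorPairing hG x y : G) = ⁅x, y⁆ := rfl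

/-! ### Amalgamating the two copies of `H` -/

section Separation

variable {G : Type u} [Group G] {A : Type*} {M : Type} [AddCommGroup A] [AddCommGroup M]

/-- The normal subgroup of the twisted product that identifies the two copies of `H`, and
identifies a central element `z` in the kernel of `π` with its value under `χ`. -/
def amalgamationSubgroup (H : Subgroup G)
    (π : G →* Multiplicative A) (γ : A →+ A →+ M) (χ : Additive (Subgroup.center G) →+ M)
    (h1 : ∀ h ∈ H, ∀ y, γ (π h).toAdd (π y).toAdd = 0) :
    Subgroup (TwistedProd π γ) where
  carrier := {p | ∃ h ∈ H, ∃ z : Subgroup.center G, π z = 1 ∧ p.left = z * h ∧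
    π p.right = (π h)⁻¹ ∧ p.val = χ (.ofMul z)}
  one_mem' := ⟨1, H.one_mem, 1, by simp, by simp, by simp, by simp⟩
  mul_mem' := by
    rintro a b ⟨h, hh, z, hz, ha, ha', ha''⟩ ⟨k, hk, w, hw, hb, hb', hb''⟩
    refine ⟨h * k, H.mul_mem hh hk, z * w, by simp [hz, hw], ?_, ?_, ?_⟩
    · have := Subgroup.mem_center_iff.1 w.2 h
      simp only [TwistedProd.mul_left, ha, hb, Subgroup.coe_mul]
      rw [mul_assoc, ← mul_assoc h, this]
      group
    · simp [ha', hb', mul_comm]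
    · simp [ha'', hb'', hb, hw, h1 k hk]
  inv_mem' := by
    rintro a ⟨h, hh, z, hz, ha, ha', ha''⟩
    refine ⟨h⁻¹, H.inv_mem hh, z⁻¹, by simp [hz], ?_, ?_, ?_⟩
    · have := Subgroup.mem_center_iff.1 (z⁻¹).2 h⁻¹
      simp only [TwistedProd.inv_left, ha, mul_inv_rev]
      exact this
    · simp [ha']
    · simp [ha'', ha, hz, h1 h hh]

/-- Conjugation by `p` replaces `z` by `z[p.left, h]` and adds `γ(p.left, h)` to the central
coordinate, the other correction being zero by `h1`; `h2` makes the two changes match. -/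
theorem normal_amalgamationSubgroup (hG : NilpotentOfClassLE 2 G) (H : Subgroup G)
    (π : G →* Multiplicative A) (γ : A →+ A →+ M) (χ : Additive (Subgroup.center G) →+ M)
    (h1 : ∀ h ∈ H, ∀ y, γ (π h).toAdd (π y).toAdd = 0)
    (h2 : ∀ x, ∀ h ∈ H, γ (π x).toAdd (π h).toAdd = χ (.ofMul (commutatorPairing hG x h))) :
    (amalgamationSubgroup H π γ χ h1).Normal := by
  constructor
  rintro n ⟨h, hh, z, hz, hn, hn', hn''⟩ p
  refine ⟨h, hh, z * commutatorPairing hG p.left h, ?_, ?_, ?_, ?_⟩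
  · simp [hz, commutatorElement_def, mul_comm]
  · have := Subgroup.mem_center_iff.1 z.2 p.left
    simp only [TwistedProd.mul_left, TwistedProd.inv_left, hn, Subgroup.coe_mul,
      coe_commutatorPairing, commutatorElement_def]
    rw [← mul_assoc, this]
    group
  · simp [hn']
  · have e1 : χ (.ofMul (z * commutatorPairing hG p.left h)) =
        n.val + γ (π p.left).toAdd (π h).toAdd := by
      rw [hn'', h2 _ h hh, ofMul_mul, map_add]
    rw [e1]
    simp [hn, hz, hn', h1 h hh]
    abel

/-- In the quotient the second copy of `c` is trivial, while the first becomes the central value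
`-χ(c)`. This survives because `χ` vanishes on the central elements of `H`. -/
theorem exists_homs_ne (hG : NilpotentOfClassLE 2 G) (H : Subgroup G)
    (π : G →* Multiplicative A) (γ : A →+ A →+ M) (χ : Additive (Subgroup.center G) →+ M)
    (h1 : ∀ h ∈ H, ∀ y, γ (π h).toAdd (π y).toAdd = 0)
    (h2 : ∀ x, ∀ h ∈ H, γ (π x).toAdd (π h).toAdd = χ (.ofMul (commutatorPairing hG x h)))
    (hχ : ∀ z : Subgroup.center G, (z : G) ∈ H → χ (.ofMul z) = 0)
    (c : Subgroup.center G) (hπc : π c = 1) (hc : χ (.ofMul c) ≠ 0) :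
    ∃ (K : Type u) (_ : Group K), NilpotentOfClassLE 2 K ∧ ∃ f g : G →* K,
      (∀ h ∈ H, f h = g h) ∧ f c ≠ g c := by
  have := normal_amalgamationSubgroup hG H π γ χ h1 h2
  let N := amalgamationSubgroup H π γ χ h1
  refine ⟨TwistedProd π γ ⧸ N, inferInstance,
    (TwistedProd.nilpotentOfClassLE_two hG).of_surjective _ (QuotientGroup.mk'_surjective N),
    (QuotientGroup.mk' N).comp TwistedProd.inl, (QuotientGroup.mk' N).comp TwistedProd.inr,
    ?_, ?_⟩
  · intro h hh
    refine QuotientGroup.eq.2 ⟨h⁻¹, H.inv_mem hh, 1, ?_⟩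
    simp
  · intro he
    obtain ⟨h, hh, z, hz, hl, -, hv⟩ := QuotientGroup.eq.1 he
    simp [hπc] at hl hv
    have hzc : ((c * z : Subgroup.center G) : G) = h⁻¹ := by
      rw [Subgroup.coe_mul, ← mul_inv_eq_one, inv_inv, mul_assoc, ← hl, mul_inv_cancel]
    have := hχ (c * z) (hzc ▸ H.inv_mem hh)
    rw [ofMul_mul, map_add, ← hv, add_zero] at this
    exact hc this

end Separation

/-! ### The two inclusions -/

section Dominion

variable {G : Type u} [Group G]

theorem Abelianization.exists_mul_mem_of_of_eq {h x : G}
    (e : Abelianization.of h = Abelianization.of x) : ∃ x' ∈ commutator G, x * x' = h :=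
  ⟨x⁻¹ * h, QuotientGroup.eq.1 e.symm, by group⟩

/-- The pairing on the abelianization obtained from the commutator pairing and a character of the
center. -/
noncomputable def abelianizationPairing {M : Type*} [AddCommGroup M]
    (hG : NilpotentOfClassLE 2 G) (χ : Additive (Subgroup.center G) →+ M) :
    Additive (Abelianization G) →ₗ[ℤ] Additive (Abelianization G) →ₗ[ℤ] M :=
  let β : Abelianization G →* Abelianization G →* Subgroup.center G :=
    Abelianization.lift (MonoidHom.mk' (fun x => Abelianization.lift (commutatorPairing hG x)) (by
      intro x x'
      ext y
      simp))
  (AddMonoidHom.mk' (fun x => (χ.comp (MonoidHom.toAdditive (β x.toMul))).toIntLinearMap) (by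
    intro x x'
    ext y
    simp)).toIntLinearMap

theorem abelianizationPairing_of {M : Type*} [AddCommGroup M]
    (hG : NilpotentOfClassLE 2 G) (χ : Additive (Subgroup.center G) →+ M) (x y : G) :
    abelianizationPairing hG χ (.ofMul (Abelianization.of x)) (.ofMul (Abelianization.of y)) =
      χ (.ofMul (commutatorPairing hG x y)) := rfl

/-- The quotient map to `Gᵃᵇ/im H` and the trivial map agree on `H`. -/
theorem exists_abelianization_eq_of_mem_dominion {H : Subgroup G} {a : G}
    (ha : a ∈ dominion (fun (K : Type u) [Group K] => NilpotentOfClassLE 2 K) H) :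
    ∃ h ∈ H, Abelianization.of h = Abelianization.of a := by
  have h := ha (Abelianization G ⧸ H.map Abelianization.of)
    (by
      refine nilpotentOfClassLE_two_iff.2 ?_
      intro x y z
      rw [commutatorElement_eq_one_iff_mul_comm.2 (mul_comm x y), commutatorElement_one_left])
    ((QuotientGroup.mk' _).comp Abelianization.of) 1
    (fun h hh => (QuotientGroup.eq_one_iff _).2 (Subgroup.mem_map_of_mem _ hh))
  exact (QuotientGroup.eq_one_iff _).1 h

theorem commutator_pow_mem_dominion {H : Subgroup G}
    {x y x' y' : G} {q : ℕ} (hx' : x' ∈ commutator G) (hy' : y' ∈ commutator G)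
    (hx : x ^ q * x' ∈ H) (hy : y ^ q * y' ∈ H) :
    ⁅x, y⁆ ^ q ∈ dominion (fun (K : Type u) [Group K] => NilpotentOfClassLE 2 K) H := by
  intro K _ hK f g hfg
  have hcen : ∀ (φ : G →* K), ∀ z ∈ commutator G, φ z ∈ Subgroup.center K := by
    intro φ z hz
    have : commutator G ≤ (Subgroup.center K).comap φ := by
      rw [commutator_def, Subgroup.commutator_le]
      intro a _ b _
      rw [Subgroup.mem_comap, map_commutatorElement]
      exact hK.commutator_mem_center _ _
    exact this hz
  have hl : ∀ a b z : K, z ∈ Subgroup.center K → ⁅a * z, b⁆ = ⁅a, b⁆ := by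
    intro a b z hz
    have h1 : ⁅z, b⁆ = 1 :=
      commutatorElement_eq_one_iff_mul_comm.2 (Subgroup.mem_center_iff.1 hz b).symm
    have h2 : ⁅a * z, b⁆ = ⁅a, b⁆ * ⁅z, b⁆ :=
      congrArg Subtype.val (DFunLike.congr_fun (map_mul (commutatorPairing hK) a z) b)
    rw [h2, h1, mul_one]
  have hr : ∀ a b z : K, z ∈ Subgroup.center K → ⁅a, b * z⁆ = ⁅a, b⁆ := by
    intro a b z hz
    rw [← commutatorElement_inv, hl _ _ _ hz, commutatorElement_inv]
  have hpl : ∀ a b : K, ⁅a ^ q, b⁆ = ⁅a, b⁆ ^ q := by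
    intro a b
    exact congrArg Subtype.val
      (DFunLike.congr_fun (map_pow (commutatorPairing hK) a q) b)
  have hpr : ∀ a b : K, ⁅a, b ^ q⁆ = ⁅a, b⁆ ^ q := by
    intro a b
    exact congrArg Subtype.val (map_pow (commutatorPairing hK a) b q)
  -- Two homomorphisms are allowed because the mixed power `⁅f x, g y⁆ ^ q` links `⁅f x, f y⁆ ^ q`
  -- to `⁅g x, g y⁆ ^ q`.
  have key : ∀ φ ψ : G →* K, ⁅φ x, ψ y⁆ ^ q = ⁅φ (x ^ q * x'), ψ y⁆ := by
    intro φ ψ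
    rw [map_mul, hl _ _ _ (hcen φ x' hx'), map_pow, hpl]
  have key' : ∀ φ ψ : G →* K, ⁅φ x, ψ y⁆ ^ q = ⁅φ x, ψ (y ^ q * y')⁆ := by
    intro φ ψ
    rw [map_mul, hr _ _ _ (hcen ψ y' hy'), map_pow, hpr]
  rw [map_pow, map_pow, map_commutatorElement, map_commutatorElement, key', hfg _ hy, ← key', key,
    hfg _ hx, ← key]

theorem mem_of_mem_dominion_of_mem_commutator (hG : NilpotentOfClassLE 2 G) {H D : Subgroup G}
    (hHD : H ≤ D)
    (hD : ∀ (x y : G) (q : ℕ), (∃ h ∈ H, Abelianization.of h = Abelianization.of x ^ q) →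
      (∃ h ∈ H, Abelianization.of h = Abelianization.of y ^ q) → ⁅x, y⁆ ^ q ∈ D)
    {c : G} (hc : c ∈ dominion (fun (K : Type u) [Group K] => NilpotentOfClassLE 2 K) H)
    (hcG : c ∈ commutator G) : c ∈ D := by
  have hcZ : c ∈ Subgroup.center G := by
    have : commutator G ≤ Subgroup.center G := by
      rw [commutator_def, Subgroup.commutator_le]
      exact fun a _ b _ => hG.commutator_mem_center a b
    exact this hcG
  by_contra hcD
  let Q := Subgroup.center G ⧸ D.subgroupOf (Subgroup.center G)
  have hne : (Additive.ofMul (QuotientGroup.mk (⟨c, hcZ⟩ : Subgroup.center G) : Q)) ≠ 0 := by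
    intro h0
    exact hcD ((QuotientGroup.eq_one_iff _).1 h0 : _)
  obtain ⟨χ₀, hχ₀⟩ := CharacterModule.exists_character_apply_ne_zero_of_ne_zero hne
  let χ : Additive (Subgroup.center G) →+ AddCircle (1 : ℚ) :=
    AddMonoidHom.comp χ₀ (MonoidHom.toAdditive
      (QuotientGroup.mk' (D.subgroupOf (Subgroup.center G))))
  have hχD : ∀ z : Subgroup.center G, (z : G) ∈ D → χ (.ofMul z) = 0 := by
    intro z hz
    have : (QuotientGroup.mk z : Q) = 1 := (QuotientGroup.eq_one_iff z).2 hz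
    change χ₀ (.ofMul (QuotientGroup.mk z : Q)) = 0
    rw [this, ofMul_one, map_zero]
  let B : Submodule ℤ (Additive (Abelianization G)) :=
    AddSubgroup.toIntSubmodule (Subgroup.toAddSubgroup (H.map Abelianization.of))
  have hB : ∀ h ∈ H, Additive.ofMul (Abelianization.of h) ∈ B := fun h hh =>
    (Subgroup.mem_map_of_mem Abelianization.of hh : _)
  -- The pairing criterion uses integer multiples, `hD` natural exponents; `B` is closed under
  -- negation.
  have hBpow : ∀ (x : G) (q : ℤ), q • Additive.ofMul (Abelianization.of x) ∈ B →
      ∃ h ∈ H, Abelianization.of h = Abelianization.of x ^ q.natAbs := by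
    intro x q hq
    have : (q.natAbs : ℤ) • Additive.ofMul (Abelianization.of x) ∈ B := by
      rcases Int.natAbs_eq q with h | h
      · rwa [← h]
      · rw [← neg_neg (q.natAbs : ℤ), ← h, neg_smul]
        exact B.neg_mem hq
    rw [natCast_zsmul] at this
    exact this
  obtain ⟨γ, h1, h2⟩ := exists_pairing_extension B (abelianizationPairing hG χ) (by
    intro x y q hx hy
    obtain ⟨x, rfl⟩ : ∃ x₀, Additive.ofMul (Abelianization.of x₀) = x :=
      QuotientGroup.mk_surjective x.toMul
    obtain ⟨y, rfl⟩ : ∃ y₀, Additive.ofMul (Abelianization.of y₀) = y :=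
      QuotientGroup.mk_surjective y.toMul
    have h0 := hχD (commutatorPairing hG x y ^ q.natAbs) (hD x y _ (hBpow x q hx) (hBpow y q hy))
    rw [ofMul_pow, map_nsmul] at h0
    rw [abelianizationPairing_of]
    rcases Int.natAbs_eq q with h | h
    · rw [h, natCast_zsmul, h0]
    · rw [h, neg_smul, natCast_zsmul, h0, neg_zero])
  let π : G →* Multiplicative (Additive (Abelianization G)) :=
    MonoidHom.mk' (fun x => .ofAdd (.ofMul (Abelianization.of x))) fun x y => by
      rw [map_mul]; rfl
  obtain ⟨K, _, hK, f, g, hfg, hne'⟩ := exists_homs_ne hG H π γ χ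
    (fun h hh y => h1 _ (hB h hh) _)
    (fun x h hh => (h2 _ _ (hB h hh)).trans (abelianizationPairing_of hG χ x h))
    (fun z hz => hχD z (hHD hz)) ⟨c, hcZ⟩
    (by
      have : Abelianization.of c = 1 := (QuotientGroup.eq_one_iff c).2 hcG
      exact this) hχ₀
  exact hne' (hc K hK f g hfg)

end Dominion

theorem theorem3p31 {G : Type u} [Group G] (hG : NilpotentOfClassLE 2 G) (H : Subgroup G) :
    dominion (fun (K : Type u) [Group K] => NilpotentOfClassLE 2 K) H =
      Subgroup.closure ((H : Set G) ∪
        {d | ∃ (x y : G) (q : ℕ) (x' y' : G), x' ∈ commutator G ∧ y' ∈ commutator G ∧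
          x ^ q * x' ∈ H ∧ y ^ q * y' ∈ H ∧ d = (x⁻¹ * y⁻¹ * x * y) ^ q}) := by
  have hHd : H ≤ dominion (fun (K : Type u) [Group K] => NilpotentOfClassLE 2 K) H :=
    fun h hh K _ _ f g hfg => hfg h hh
  -- The two commutator conventions agree in class two, since inverting both entries changes the
  -- sign twice.
  have hconj : ∀ x y : G, x⁻¹ * y⁻¹ * x * y = ⁅x, y⁆ := by
    intro x y
    have h1 : ⁅x⁻¹, y⁻¹⁆ = ⁅x, y⁻¹⁆⁻¹ :=
      congrArg Subtype.val (DFunLike.congr_fun (map_inv (commutatorPairing hG) x) y⁻¹)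
    have h2 : ⁅x, y⁻¹⁆ = ⁅x, y⁆⁻¹ := congrArg Subtype.val (map_inv (commutatorPairing hG x) y)
    rw [h2, inv_inv, commutatorElement_def, inv_inv, inv_inv] at h1
    exact h1
  apply le_antisymm
  · intro a ha
    set D := Subgroup.closure ((H : Set G) ∪
        {d | ∃ (x y : G) (q : ℕ) (x' y' : G), x' ∈ commutator G ∧ y' ∈ commutator G ∧
          x ^ q * x' ∈ H ∧ y ^ q * y' ∈ H ∧ d = (x⁻¹ * y⁻¹ * x * y) ^ q}) with hDdef
    have hHD : H ≤ D := fun h hh => Subgroup.subset_closure (Or.inl hh)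
    obtain ⟨h, hh, he⟩ := exists_abelianization_eq_of_mem_dominion ha
    have hmem : h⁻¹ * a ∈ D := by
      refine mem_of_mem_dominion_of_mem_commutator hG hHD ?_
        (mul_mem (inv_mem (hHd hh)) ha) (QuotientGroup.eq.1 he)
      rintro x y q ⟨u, hu, hux⟩ ⟨v, hv, hvy⟩
      rw [← map_pow] at hux hvy
      obtain ⟨x', hx', rfl⟩ := Abelianization.exists_mul_mem_of_of_eq hux
      obtain ⟨y', hy', rfl⟩ := Abelianization.exists_mul_mem_of_of_eq hvy
      exact Subgroup.subset_closure (Or.inr ⟨x, y, q, x', y', hx', hy', hu, hv, by rw [hconj]⟩)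
    simpa using mul_mem (hHD hh) hmem
  · rw [Subgroup.closure_le]
    rintro d (hd | ⟨x, y, q, x', y', hx', hy', hx, hy, rfl⟩)
    · exact hHd hd
    · rw [hconj]
      exact commutator_pow_mem_dominion hx' hy' hx hy
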